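/- Let $(W,S)$ be a right-angled Coxeter system with $S$ finite, i.e. $m_{st}\in\{1,2,\infty\}$ for all $s,t\in S$, with length function $|\cdot|$. Let $R$ be a commutative ring and let $a=(a_s)_{s\in S}$, $b=(b_s)_{s\in S}$ be elements of $R$. Let $\mathcal H=\mathcal H(W,S,a,b)$ be the generic Hecke algebra: the $R$-algebra that is free as an $R$-module with basis $(T_w)_{w\in W}$ and satisfies $T_sT_w=T_{sw}$ if $|sw|>|w|$ and $T_sT_w=a_sT_w+b_sT_{sw}$ if $|sw|<|w|$, for $s\in S$, $w\in W$. A trace on $\mathcal H$ is an $R$-linear map $\varphi\colon\mathcal H\to R$ with $\varphi(xy)=\varphi(yx)$ for all $x,y$; the cocentre is $\mathcal H/[\mathcal H,\mathcal H]$, where $[\mathcal H,\mathcal H]$ is the $R$-submodule spanned by all $xy-yx$. Fix a total order on $S$ and let $\Phi_0\colon\mathcal H\to\mathcal H$ be the linear map with $\Phi_0(T_w)=T_w$ if $w$ is of minimal length in its conjugacy class, and otherwise $\Phi_0(T_w)=T_{sws}T_s^2$, where $s\in S$ is the least element with $|sws|<|w|$. Let $\Phi$ be the linear map for which $\Phi(T_w)$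 is the eventual value of $\Phi_0^n(T_w)$ as $n\to\infty$ (the sequence is constant from $n=|w|$ on). For a conjugacy class $\mathcal O\subseteq W$ let $\Sigma_{\mathcal O}\colon\mathcal H\to R$ be the linear map with $\Sigma_{\mathcal O}(T_w)=1$ if $w\in\mathcal O$ and $w$ is of minimal length in $\mathcal O$, and $\Sigma_{\mathcal O}(T_w)=0$ otherwise. Put $\varphi_{\mathcal O}=\Sigma_{\mathcal O}\circ\Phi$. Then: 1. For every conjugacy class $\mathcal O$, the map $\varphi_{\mathcal O}$ is a trace on $\mathcal H$. For every conjugacy class $\mathcal U$ the class $T_{\mathcal U}=T_w+[\mathcal H,\mathcal H]$ does not depend on the choice of the element $w\in\mathcal U$ of minimal length, the family $(T_{\mathcal U})_{\mathcal U}$, indexed by the conjugacy classes of $W$, is a basis of the cocentre of $\mathcal H$, and the functionals on the cocentre induced by the $\varphi_{\mathcal O}$ are dual to it: $\varphi_{\mathcal O}(T_{\mathcal U})=\delta_{\mathcal O,\mathcal U}$. 2. Let $q=(q_s)_{s\in S}$ be positive real numbers and let $\mathcal H=\mathcal H(W,S,p,1)$ be the complex Iwahori–Hecke algebra, $p_s=q_s^{1/2}-q_s^{-1/2}$,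 over $R=\mathbb C$. Then for every conjugacy class $\mathcal O$ the map $\varphi_{\mathcal O}$ is the unique trace $\psi$ on $\mathcal H$ satisfying $\psi(T_w)=\mathbb 1_{\mathcal O}(w)$ for every $w\in W$ that is of minimal length in its conjugacy class. -/

import Mathlib

/-- A Coxeter matrix is right-angled if all its entries lie in `{1, 2, ∞}`
(Mathlib encodes `∞` as `0`). -/
def CoxeterMatrix.IsRightAngled {B : Type*} (M : CoxeterMatrix B) : Prop :=
  ∀ s t, M s t = 1 ∨ M s t = 2 ∨ M s t = 0

namespace RightAngledHecke

noncomputable section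

/-! ### Cocentres and traces -/

/-- The subspace `[A, A]` generated by the additive commutators `x y - y x`. -/
def commutatorSubspace (R A : Type*) [CommRing R] [Ring A] [Algebra R A] : Submodule R A :=
  Submodule.span R {z | ∃ x y : A, z = x * y - y * x}

/-- The cocentre `A / [A, A]`. -/
def Cocentre (R A : Type*) [CommRing R] [Ring A] [Algebra R A] : Type _ :=
  A ⧸ commutatorSubspace R A

instance (R A : Type*) [CommRing R] [Ring A] [Algebra R A] : AddCommGroup (Cocentre R A) :=
  Submodule.Quotient.addCommGroup (commutatorSubspace R A)

instance (R A : Type*) [CommRing R] [Ring A] [Algebra R A] : Module R (Cocentre R A) :=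
  Submodule.Quotient.module (commutatorSubspace R A)

/-- The quotient map onto the cocentre. -/
def Cocentre.mk (R A : Type*) [CommRing R] [Ring A] [Algebra R A] : A →ₗ[R] Cocentre R A :=
  (commutatorSubspace R A).mkQ

/-- A trace on an `R`-algebra is an `R`-linear functional that vanishes on commutators. -/
def IsTrace (R A : Type*) [CommRing R] [Ring A] [Algebra R A] (φ : A →ₗ[R] R) : Prop :=
  ∀ x y : A, φ (x * y) = φ (y * x)

/-- The functional on the cocentre induced by a trace. -/
def IsTrace.toCocentre {R A : Type*} [CommRing R] [Ring A] [Algebra R A] {φ : A →ₗ[R] R}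
    (h : IsTrace R A φ) : Cocentre R A →ₗ[R] R :=
  (commutatorSubspace R A).liftQ φ (Submodule.span_le.mpr (by
    rintro _ ⟨x, y, rfl⟩
    change φ (x * y - y * x) = 0
    rw [map_sub, h x y, sub_self]))

section Hecke

variable {B W R : Type*} [Group W] {M : CoxeterMatrix B} (cs : CoxeterSystem M W)
  [CommRing R] (a b : B → R)

/-- `w` is of minimal length in its conjugacy class. -/
def IsMinLength (w : W) : Prop := ∀ v : W, IsConj w v → cs.length w ≤ cs.length v

/-! ### The generic Hecke algebra

It is realised through its left regular representation on the free module with basis `W`. The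
facts proved below show that this is the free module with basis `T` and the defining
multiplication rule. -/

/-- Left multiplication by `T_s` on the free module with basis `W`. -/
def leftOp (s : B) : Module.End R (W →₀ R) :=
  Finsupp.lift (W →₀ R) R W fun w =>
    if cs.length w < cs.length (cs.simple s * w) then Finsupp.single (cs.simple s * w) 1
    else a s • Finsupp.single w 1 + b s • Finsupp.single (cs.simple s * w) 1

/-- Right multiplication by `T_t`; only used in the proof that `T` is a basis. -/
def rightOp (t : B) : Module.End R (W →₀ R) :=
  Finsupp.lift (W →₀ R) R W fun w =>
    if cs.length w < cs.length (w * cs.simple t) then Finsupp.single (w * cs.simple t) 1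
    else a t • Finsupp.single w 1 + b t • Finsupp.single (w * cs.simple t) 1

/-- The generic Hecke algebra with deformation parameters `a`, `b`: the unital `R`-algebra of
operators generated by the left multiplications `T_s`. -/
def Hecke : Type _ := Algebra.adjoin R (Set.range (leftOp cs a b))

instance : Ring (Hecke cs a b) :=
  Subalgebra.toRing (Algebra.adjoin R (Set.range (leftOp cs a b)))

instance : Algebra R (Hecke cs a b) :=
  Subalgebra.algebra (Algebra.adjoin R (Set.range (leftOp cs a b)))

theorem leftOp_single (s : B) (w : W) : leftOp cs a b s (Finsupp.single w 1) =
    if cs.length w < cs.length (cs.simple s * w) then Finsupp.single (cs.simple s * w) 1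
    else a s • Finsupp.single w 1 + b s • Finsupp.single (cs.simple s * w) 1 := by
  simp only [leftOp, Finsupp.lift_apply, Finsupp.sum_single_index, zero_smul, one_smul]

theorem rightOp_single (t : B) (w : W) : rightOp cs a b t (Finsupp.single w 1) =
    if cs.length w < cs.length (w * cs.simple t) then Finsupp.single (w * cs.simple t) 1
    else a t • Finsupp.single w 1 + b t • Finsupp.single (w * cs.simple t) 1 := by
  simp only [rightOp, Finsupp.lift_apply, Finsupp.sum_single_index, zero_smul, one_smul]

variable {cs} in
open Classical in
theorem simple_conj_eq (hM : M.IsRightAngled) {s t : B} {w : W}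
    (h : cs.simple s * w = w * cs.simple t) : s = t := by
  have two (x : B → ZMod 2) : x + x = 0 := by
    funext i; exact CharTwo.add_self_eq_zero _
  have hl : M.IsLiftable
      (fun i : B => Multiplicative.ofAdd (Pi.single i (1 : ZMod 2) : B → ZMod 2)) := by
    intro i j
    have hsq (x : Multiplicative (B → ZMod 2)) : x ^ 2 = 1 := by
      rw [pow_two]; exact two x.toAdd
    rcases hM i j with h1 | h1 | h1
    · have : i = j := by
        by_contra hne; exact M.off_diagonal i j hne h1
      subst this
      rw [h1, pow_one, ← pow_two]; exact hsq _
    · rw [h1]; exact hsq _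
    · rw [h1, pow_zero]
  have h2 := congrArg (cs.lift ⟨_, hl⟩) h
  rw [map_mul, map_mul, mul_comm, mul_left_cancel_iff, CoxeterSystem.lift_apply_simple,
    CoxeterSystem.lift_apply_simple] at h2
  have h3 := congrFun (Multiplicative.ofAdd.injective h2) s
  by_contra hne
  simp [hne] at h3

open Classical in
/-- The map on `W × ℤ/2` attached to a simple reflection that counts inversions modulo two; only
used in the proof of the exchange property. -/
def flip (s : B) (p : W × ZMod 2) : W × ZMod 2 :=
  (cs.simple s * p.1 * cs.simple s, p.2 + if p.1 = cs.simple s then 1 else 0)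

open Classical in
theorem flip_self (s : B) (p : W × ZMod 2) : flip cs s (flip cs s p) = p := by
  obtain ⟨r, e⟩ := p
  have h : cs.simple s * r * cs.simple s = cs.simple s ↔ r = cs.simple s := by
    rw [mul_eq_right, mul_eq_one_iff_eq_inv', cs.inv_simple]
  ext
  · simp [flip, mul_assoc]
  · change e + (if r = cs.simple s then 1 else 0) +
        (if cs.simple s * r * cs.simple s = cs.simple s then 1 else 0) = e
    rw [if_congr h rfl rfl, add_assoc, CharTwo.add_self_eq_zero, add_zero]

open Classical in
theorem flip_comm (s t : B) (p : W × ZMod 2)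
    (hst : cs.simple s * cs.simple t = cs.simple t * cs.simple s) :
    flip cs s (flip cs t p) = flip cs t (flip cs s p) := by
  obtain ⟨r, e⟩ := p
  have key (s t : B) (hst : cs.simple s * cs.simple t = cs.simple t * cs.simple s) :
      cs.simple t * r * cs.simple t = cs.simple s ↔ r = cs.simple s := by
    constructor
    · intro h
      have : r = cs.simple t * (cs.simple t * r * cs.simple t) * cs.simple t := by
        simp [mul_assoc]
      rw [this, h, ← hst]; simp
    · rintro rfl; rw [← hst]; simp
  ext
  · simp only [flip]
    calc cs.simple s * (cs.simple t * r * cs.simple t) * cs.simple s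
        = (cs.simple s * cs.simple t) * r * (cs.simple t * cs.simple s) := by group
      _ = (cs.simple t * cs.simple s) * r * (cs.simple s * cs.simple t) := by rw [hst]
      _ = _ := by group
  · change e + (if r = cs.simple t then 1 else 0) +
        (if cs.simple t * r * cs.simple t = cs.simple s then 1 else 0) =
      e + (if r = cs.simple s then 1 else 0) +
        (if cs.simple s * r * cs.simple s = cs.simple t then 1 else 0)
    rw [if_congr (key s t hst) rfl rfl, if_congr (key t s hst.symm) rfl rfl]
    exact add_right_comm _ _ _

theorem exists_flip_hom (hM : M.IsRightAngled) :
    ∃ ρ : W →* Function.End (W × ZMod 2), ∀ s, ρ (cs.simple s) = flip cs s := by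
  have hl : M.IsLiftable (G := Function.End (W × ZMod 2)) (fun s => flip cs s) := by
    intro s t
    rcases hM s t with h1 | h1 | h1
    · have : s = t := by
        by_contra hne; exact M.off_diagonal s t hne h1
      subst this
      rw [h1, pow_one]; funext p; exact flip_self cs s p
    · have hst : cs.simple s * cs.simple t = cs.simple t * cs.simple s := by
        have := cs.simple_mul_simple_pow s t
        rw [h1, pow_two, mul_eq_one_iff_eq_inv] at this
        simpa using this
      rw [h1, pow_two]; funext p
      change flip cs s (flip cs t (flip cs s (flip cs t p))) = p
      rw [flip_comm cs s t _ hst, flip_self, flip_self]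
    · rw [h1, pow_zero]
  exact ⟨cs.lift ⟨_, hl⟩, fun s => cs.lift_apply_simple hl s⟩

open Classical in
theorem count_parity (hM : M.IsRightAngled) {ω ω' : List B} (r : W)
    (h : cs.wordProd ω = cs.wordProd ω') :
    (((cs.rightInvSeq ω).count r : ℕ) : ZMod 2) = ((cs.rightInvSeq ω').count r : ℕ) := by
  obtain ⟨ρ, hρ⟩ := exists_flip_hom cs hM
  have key (ω : List B) : ρ (cs.wordProd ω) (r, 0) =
      (cs.wordProd ω * r * (cs.wordProd ω)⁻¹, (((cs.rightInvSeq ω).count r : ℕ) : ZMod 2)) := by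
    induction ω with
    | nil =>
      rw [cs.wordProd_nil, map_one]
      change (r, (0 : ZMod 2)) = _
      simp
    | cons i ω ih =>
      rw [cs.wordProd_cons, map_mul, hρ]
      change flip cs i (ρ (cs.wordProd ω) (r, 0)) = _
      rw [ih, CoxeterSystem.rightInvSeq, List.count_cons]
      have h1 : cs.wordProd ω * r * (cs.wordProd ω)⁻¹ = cs.simple i ↔
          (cs.wordProd ω)⁻¹ * cs.simple i * cs.wordProd ω = r := by
        rw [mul_inv_eq_iff_eq_mul, mul_assoc, inv_mul_eq_iff_eq_mul, eq_comm]
      ext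
      · simp [flip, mul_assoc]
      · simp only [flip, h1, beq_iff_eq]
        push_cast
        rfl
  have := congrArg Prod.snd (key ω)
  rw [h, key ω'] at this
  exact this.symm

variable {cs} in
theorem exchange (hM : M.IsRightAngled) {s t : B} {w : W}
    (h1 : cs.length w < cs.length (cs.simple s * w))
    (h2 : cs.length w < cs.length (w * cs.simple t))
    (h3 : cs.length (cs.simple s * w * cs.simple t) < cs.length (cs.simple s * w)) :
    cs.simple s * w = w * cs.simple t := by
  classical
  obtain ⟨ω, hω, rfl⟩ := cs.exists_isReduced w
  obtain ⟨ν, hν, hνe⟩ := cs.exists_isReduced (cs.simple s * cs.wordProd ω * cs.simple t)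
  have e1 : cs.wordProd (ν.concat t) = cs.simple s * cs.wordProd ω := by
    rw [cs.wordProd_concat, ← hνe]; simp
  have hred : cs.IsReduced (ν.concat t) := by
    rcases cs.length_mul_simple (cs.simple s * cs.wordProd ω) t with h4 | h4
    · omega
    · have h5 : cs.length (cs.wordProd ν) = ν.length := hν
      rw [← hνe] at h5
      unfold CoxeterSystem.IsReduced
      rw [e1, List.length_concat]; omega
  have hmem : cs.simple t ∈ cs.rightInvSeq (ν.concat t) := by
    rw [cs.rightInvSeq_concat]; simp
  have hc := count_parity cs hM (cs.simple t) (e1.trans (cs.wordProd_cons s ω).symm)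
  rw [List.count_eq_one_of_mem hred.nodup_rightInvSeq hmem] at hc
  have hmem' : cs.simple t ∈ cs.rightInvSeq (s :: ω) := by
    by_contra hn
    rw [List.count_eq_zero_of_not_mem hn] at hc
    simp at hc
  rw [CoxeterSystem.rightInvSeq, List.mem_cons] at hmem'
  rcases hmem' with h4 | h4
  · rw [h4]; group
  · have := (cs.isRightInversion_of_mem_rightInvSeq hω h4).2
    omega

theorem leftOp_rightOp (hM : M.IsRightAngled) (s t : B) :
    leftOp cs a b s * rightOp cs a b t = rightOp cs a b t * leftOp cs a b s := by
  apply Finsupp.lhom_ext'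
  intro w
  apply LinearMap.ext_ring
  change leftOp cs a b s (rightOp cs a b t (Finsupp.single w 1)) =
    rightOp cs a b t (leftOp cs a b s (Finsupp.single w 1))
  rw [leftOp_single, rightOp_single]
  have hA := cs.length_simple_mul w s
  have hB := cs.length_mul_simple w t
  have hC := cs.length_simple_mul (w * cs.simple t) s
  have hD := cs.length_mul_simple (cs.simple s * w) t
  have hE : cs.simple s * (w * cs.simple t) = cs.simple s * w * cs.simple t := by group
  rw [hE] at hC
  by_cases A : cs.length w < cs.length (cs.simple s * w) <;>
    by_cases B' : cs.length w < cs.length (w * cs.simple t) <;>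
    simp only [A, B', if_true, if_false, map_add, map_smul, leftOp_single, rightOp_single, hE]
  · by_cases C : cs.length (w * cs.simple t) < cs.length (cs.simple s * w * cs.simple t)
    · rw [if_pos C, if_pos (by omega)]
    · have h := exchange hM A B' (by omega)
      have hst := simple_conj_eq hM h
      rw [if_neg C, if_neg (by omega), ← h, hst]
  · rw [if_pos (by omega), if_neg (by omega)]
  · rw [if_neg (by omega), if_pos (by omega)]
  · by_cases C : cs.length (w * cs.simple t) < cs.length (cs.simple s * w * cs.simple t)
    · have e : cs.simple s * (cs.simple s * w) = w := by simp
      have h := exchange (cs := cs) hM (s := s) (t := t) (w := cs.simple s * w)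
        (by rw [e]; omega) (by omega) (by rw [e]; omega)
      rw [e] at h
      have h' : cs.simple s * w = w * cs.simple t := by
        rw [← cs.simple_mul_simple_cancel_right (w := cs.simple s * w) t, ← h]
      have hst := simple_conj_eq hM h'
      rw [if_pos C, if_pos (by omega), h', hst]
    · rw [if_neg C, if_neg (by omega)]
      module

/-- Evaluation at the unit vector identifies the Hecke algebra with the free module on `W`. -/
def evalOne : Hecke cs a b →ₗ[R] (W →₀ R) where
  toFun h := h.val (Finsupp.single 1 1)
  map_add' _ _ := rfl
  map_smul' _ _ := rfl

/-- The generator `T_s` as an element of the Hecke algebra. -/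
def gen (s : B) : Hecke cs a b := ⟨leftOp cs a b s, Algebra.subset_adjoin ⟨s, rfl⟩⟩

theorem exists_evalOne_eq (w : W) : ∃ h : Hecke cs a b, evalOne cs a b h = Finsupp.single w 1 := by
  obtain ⟨n, hn⟩ : ∃ n, cs.length w = n := ⟨_, rfl⟩
  induction n generalizing w with
  | zero =>
    rw [cs.length_eq_zero_iff] at hn
    subst hn
    exact ⟨1, rfl⟩
  | succ n ih =>
    have hw : w ≠ 1 := by rintro rfl; simp at hn
    obtain ⟨s, hs⟩ := cs.exists_leftDescent_of_ne_one hw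
    rw [cs.isLeftDescent_iff] at hs
    obtain ⟨h, hh⟩ := ih (cs.simple s * w) (by omega)
    refine ⟨gen cs a b s * h, ?_⟩
    change leftOp cs a b s (evalOne cs a b h) = _
    rw [hh, leftOp_single, cs.simple_mul_simple_cancel_left, if_pos (by omega)]

theorem evalOne_bijective (hM : M.IsRightAngled) : Function.Bijective (evalOne cs a b) := by
  constructor
  · rw [injective_iff_map_eq_zero]
    rintro ⟨h, hh⟩ h0
    have hcomm (t : B) : h * rightOp cs a b t = rightOp cs a b t * h := by
      have hle : Algebra.adjoin R (Set.range (leftOp cs a b)) ≤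
          Subalgebra.centralizer R {rightOp cs a b t} := by
        refine Algebra.adjoin_le ?_
        rintro _ ⟨s, rfl⟩
        rw [SetLike.mem_coe, Subalgebra.mem_centralizer_iff]
        rintro _ rfl
        exact (leftOp_rightOp cs a b hM s t).symm
      exact ((Subalgebra.mem_centralizer_iff R).1 (hle hh) _ rfl).symm
    have hz (n : ℕ) : ∀ w : W, cs.length w = n → h (Finsupp.single w 1) = 0 := by
      induction n with
      | zero =>
        intro w hn
        rw [cs.length_eq_zero_iff] at hn
        subst hn
        exact h0
      | succ n ih =>
        intro w hn
        have hw : w ≠ 1 := by rintro rfl; simp at hn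
        obtain ⟨t, ht⟩ := cs.exists_rightDescent_of_ne_one hw
        rw [cs.isRightDescent_iff] at ht
        have h1 := congrArg (fun f => f (Finsupp.single (w * cs.simple t) (1 : R))) (hcomm t)
        change h (rightOp cs a b t _) = rightOp cs a b t (h _) at h1
        rw [ih _ (by omega), map_zero, rightOp_single, cs.simple_mul_simple_cancel_right,
          if_pos (by omega)] at h1
        exact h1
    apply Subtype.ext
    apply Finsupp.lhom_ext'
    intro w
    apply LinearMap.ext_ring
    change h (Finsupp.single w 1) = 0
    exact hz _ w rfl
  · intro f
    induction f using Finsupp.induction_linear with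
    | zero => exact ⟨0, map_zero _⟩
    | add f g hf hg =>
      obtain ⟨x, rfl⟩ := hf
      obtain ⟨y, rfl⟩ := hg
      exact ⟨x + y, map_add _ _ _⟩
    | single w r =>
      obtain ⟨x, hx⟩ := exists_evalOne_eq cs a b w
      exact ⟨r • x, by rw [map_smul, hx, Finsupp.smul_single_one]⟩

/-- The designated basis `(T_w)` of the generic Hecke algebra of right-angled type. -/
def T (hM : M.IsRightAngled) : Module.Basis W R (Hecke cs a b) :=
  .ofRepr (LinearEquiv.ofBijective (evalOne cs a b) (evalOne_bijective cs a b hM))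

theorem evalOne_T (hM : M.IsRightAngled) (w : W) :
    evalOne cs a b (T cs a b hM w) = Finsupp.single w 1 :=
  (T cs a b hM).repr_self w

theorem T_one (hM : M.IsRightAngled) : T cs a b hM 1 = 1 := by
  apply (evalOne_bijective cs a b hM).1
  rw [evalOne_T]; rfl

/-- The defining multiplication rule of the generic Hecke algebra. -/
theorem T_simple_mul (hM : M.IsRightAngled) (s : B) (w : W) :
    T cs a b hM (cs.simple s) * T cs a b hM w =
      if cs.length w < cs.length (cs.simple s * w) then T cs a b hM (cs.simple s * w)
      else a s • T cs a b hM w + b s • T cs a b hM (cs.simple s * w) := by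
  have hs : T cs a b hM (cs.simple s) = gen cs a b s := by
    apply (evalOne_bijective cs a b hM).1
    rw [evalOne_T]
    change _ = leftOp cs a b s (Finsupp.single 1 1)
    rw [leftOp_single, if_pos (by simp), mul_one]
  rw [hs]
  apply (evalOne_bijective cs a b hM).1
  change leftOp cs a b s (evalOne cs a b (T cs a b hM w)) = _
  rw [evalOne_T, leftOp_single]
  split_ifs <;> simp only [map_add, map_smul, evalOne_T]

/-! ### The functionals `φ_𝒪` -/

open Classical in
/-- One step of cyclic reduction: `T_w` is fixed if `w` has minimal length in its conjugacy
class, and is otherwise sent to `T_{sws} T_s ^ 2` for the least `s` with `|sws| < |w|`. Such an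
`s` exists whenever `w` is not of minimal length, so the last branch is never used. -/
def cyclicStep [LinearOrder B] (hM : M.IsRightAngled) : Hecke cs a b →ₗ[R] Hecke cs a b :=
  (T cs a b hM).constr R fun w =>
    if IsMinLength cs w then T cs a b hM w
    else if h : ∃ s, IsLeast {s | cs.length (cs.simple s * w * cs.simple s) < cs.length w} s then
      T cs a b hM (cs.simple h.choose * w * cs.simple h.choose) *
        T cs a b hM (cs.simple h.choose) ^ 2
    else T cs a b hM w

/-- The cyclic reduction map `Φ`, with `Φ(T_w)` the eventual value of the iterates
`Φ₀ⁿ(T_w)`, which is reached after `|w|` steps (see `cyclicReduction_T`). -/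
def cyclicReduction [LinearOrder B] (hM : M.IsRightAngled) : Hecke cs a b →ₗ[R] Hecke cs a b :=
  (T cs a b hM).constr R fun w => (cyclicStep cs a b hM ^ cs.length w) (T cs a b hM w)

theorem T_mul_simple (hM : M.IsRightAngled) (s : B) (n : ℕ) : ∀ w : W, cs.length w = n →
    cs.length w < cs.length (w * cs.simple s) →
      T cs a b hM w * T cs a b hM (cs.simple s) = T cs a b hM (w * cs.simple s) := by
  induction n with
  | zero =>
    intro w hn _
    rw [cs.length_eq_zero_iff] at hn
    subst hn
    rw [T_one, one_mul, one_mul]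
  | succ n ih =>
    intro w hn hw
    have h1 : w ≠ 1 := by rintro rfl; simp at hn
    obtain ⟨r, hr⟩ := cs.exists_leftDescent_of_ne_one h1
    rw [cs.isLeftDescent_iff] at hr
    have e : cs.simple r * (cs.simple r * w) = w := by simp
    have e' : cs.simple r * (cs.simple r * w * cs.simple s) = w * cs.simple s := by
      rw [← mul_assoc, e]
    have h2 := cs.length_simple_mul (cs.simple r * w * cs.simple s) r
    have h3 := cs.length_mul_simple (cs.simple r * w) s
    rw [e'] at h2
    have h4 := T_simple_mul cs a b hM r (cs.simple r * w)
    rw [e, if_pos (by omega)] at h4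
    have h5 := T_simple_mul cs a b hM r (cs.simple r * w * cs.simple s)
    rw [e', if_pos (by omega)] at h5
    rw [← h4, mul_assoc, ih _ (by omega) (by omega), h5]

theorem cyclicStep_T [LinearOrder B] (hM : M.IsRightAngled) (w : W) :
    cyclicStep cs a b hM (T cs a b hM w) = T cs a b hM w ∨
      ∃ (c d : R) (u v : W), cs.length u < cs.length w ∧ cs.length v < cs.length w ∧
        cyclicStep cs a b hM (T cs a b hM w) = c • T cs a b hM u + d • T cs a b hM v := by
  classical
  simp only [cyclicStep, Module.Basis.constr_basis]
  split_ifs with h1 h2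
  · exact Or.inl rfl
  · right
    have hs := h2.choose_spec.1
    generalize h2.choose = s at hs
    change cs.length (cs.simple s * w * cs.simple s) < cs.length w at hs
    have e : cs.simple s * w * cs.simple s * cs.simple s = cs.simple s * w := by simp
    have h3 := cs.length_simple_mul w s
    have h4 := cs.length_mul_simple (cs.simple s * w) s
    have h5 := T_mul_simple cs a b hM s _ (cs.simple s * w * cs.simple s) rfl
      (by rw [e]; omega)
    have h6 := T_simple_mul cs a b hM s (cs.simple s)
    rw [cs.simple_mul_simple_self, if_neg (by simp), T_one] at h6
    refine ⟨a s, b s, cs.simple s * w, cs.simple s * w * cs.simple s, by omega, hs, ?_⟩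
    rw [pow_two, h6, mul_add, mul_smul_comm, mul_smul_comm, mul_one, h5, e]
  · exact Or.inl rfl

theorem cyclicStep_pow_T [LinearOrder B] (hM : M.IsRightAngled) (n : ℕ) :
    ∀ (w : W) (k : ℕ), cs.length w ≤ n → n ≤ k →
      (cyclicStep cs a b hM ^ k) (T cs a b hM w) =
        (cyclicStep cs a b hM ^ n) (T cs a b hM w) := by
  have fix (w : W) (h : cyclicStep cs a b hM (T cs a b hM w) = T cs a b hM w) (k : ℕ) :
      (cyclicStep cs a b hM ^ k) (T cs a b hM w) = T cs a b hM w := by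
    induction k with
    | zero => rfl
    | succ k ih => rw [pow_succ, Module.End.mul_apply, h, ih]
  induction n with
  | zero =>
    intro w k hw _
    rcases cyclicStep_T cs a b hM w with h | ⟨c, d, u, v, hu, hv, h⟩
    · rw [fix w h, fix w h]
    · omega
  | succ n ih =>
    intro w k hw hk
    rcases cyclicStep_T cs a b hM w with h | ⟨c, d, u, v, hu, hv, h⟩
    · rw [fix w h, fix w h]
    · obtain ⟨k, rfl⟩ : ∃ m, k = m + 1 := ⟨k - 1, by omega⟩
      rw [pow_succ, pow_succ, Module.End.mul_apply, Module.End.mul_apply, h]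
      simp only [map_add, map_smul]
      rw [ih u k (by omega) (by omega), ih v k (by omega) (by omega)]

theorem cyclicReduction_T [LinearOrder B] (hM : M.IsRightAngled) (w : W) :
    ∀ᶠ n in Filter.atTop, (cyclicStep cs a b hM ^ n) (T cs a b hM w) =
      cyclicReduction cs a b hM (T cs a b hM w) := by
  filter_upwards [Filter.eventually_ge_atTop (cs.length w)] with n hn
  rw [cyclicReduction, Module.Basis.constr_basis]
  exact cyclicStep_pow_T cs a b hM _ w n le_rfl hn

open Classical in
/-- `Σ_𝒪`: the sum of the coefficients of the elements of minimal length in `𝒪`. -/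
def sumMinCoeff (hM : M.IsRightAngled) (O : ConjClasses W) : Hecke cs a b →ₗ[R] R :=
  (T cs a b hM).constr R fun w => if ConjClasses.mk w = O ∧ IsMinLength cs w then 1 else 0

/-- `φ_𝒪 = Σ_𝒪 ∘ Φ`. -/
def delocalised [LinearOrder B] (hM : M.IsRightAngled) (O : ConjClasses W) :
    Hecke cs a b →ₗ[R] R :=
  sumMinCoeff cs a b hM O ∘ₗ cyclicReduction cs a b hM

end Hecke

/-- The deformation parameters `p_s = q_s^{1/2} - q_s^{-1/2}` of the Iwahori-Hecke algebra. -/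
def iwahoriParam {B : Type*} (q : B → ℝ) (s : B) : ℂ :=
  ((Real.sqrt (q s) - (Real.sqrt (q s))⁻¹ : ℝ) : ℂ)

/-- The Iwahori-Hecke algebra: the complex generic Hecke algebra with parameters `p` and `1`. -/
abbrev IwahoriHecke {B W : Type*} [Group W] {M : CoxeterMatrix B} (cs : CoxeterSystem M W)
    (q : B → ℝ) : Type _ :=
  Hecke cs (iwahoriParam q) (1 : B → ℂ)

end

end RightAngledHecke

namespace RightAngledHecke

/-! ### Descents of an element: two distinct descents on the same side commute. -/

section Descents

variable {B W : Type*} [Group W] {M : CoxeterMatrix B} (cs : CoxeterSystem M W)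

/-! Two facts about right-angled groups drive everything. An equality `s w = w t` forces `s = t`
(`simple_conj_eq`), and two distinct descents of an element on the same side commute
(`commute_of_right_descents`). Hence simple reflections `s ≠ t` that both shorten `w` by conjugation
commute, and whether `t` shortens an element is unchanged when the element is multiplied on the left
or right by a commuting `s`.

Two consequences follow. In the group, cyclically reduced elements are exactly those of minimal
length in their class, and any two such conjugate elements are linked by length-preserving
conjugations by simple reflections (`IsCyclicallyReduced.induction_on_isConj`). In the algebra, if
`s` shortens `w`, then the recursion `φ(T_w) = a_s φ(T_{sw}) + b_s φ(T_{sws})`, built into `φ_𝒪`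
only for the least such `s`, holds for every such `s`, because the reductions by two commuting
reflections form a diamond (`delocalised_of_length_conj_lt`). A similar induction makes `φ_𝒪`
invariant under length-preserving conjugation by simple reflections (`delocalised_simple_conj`).
Together these say `φ_𝒪(T_s T_w) = φ_𝒪(T_w T_s)`, which is enough for a trace.

In the cocentre the same recursion and the same shifts hold for the classes of the `T_w`. So the
classes of minimal length elements are well defined and span. The traces `φ_𝒪` take the values
`δ_{𝒪,𝒰}` on them, which gives linear independence and duality; spanning also gives uniqueness of a
trace with prescribed values. -/

theorem exists_inversion_cocycle (hM : M.IsRightAngled) :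
    ∃ η : W → W → ZMod 2,
      (∀ w v r, η (w * v) r = η v r + η w (v * r * v⁻¹)) ∧
      (∀ w r, η w r ≠ 0 → cs.length (w * r) < cs.length w) ∧
      ∀ w s, cs.length (w * cs.simple s) < cs.length w → η w (cs.simple s) = 1 := by
  classical
  obtain ⟨ρ, hρ⟩ := exists_flip_hom cs hM
  -- The cocycle `η w r` is the parity of the number of occurrences of `r` in the right inversion
  -- sequence of any word for `w`. It is read off as the second coordinate of `ρ w (r, 0)`, so the
  -- cocycle identity is multiplicativity of `ρ`.
  have key (ω : List B) (r : W) (e : ZMod 2) : ρ (cs.wordProd ω) (r, e) =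
      (cs.wordProd ω * r * (cs.wordProd ω)⁻¹, e + ((cs.rightInvSeq ω).count r : ℕ)) := by
    induction ω with
    | nil =>
      rw [cs.wordProd_nil, map_one]
      change (r, e) = _
      simp
    | cons i ω ih =>
      rw [cs.wordProd_cons, map_mul, hρ]
      change flip cs i (ρ (cs.wordProd ω) (r, e)) = _
      rw [ih, CoxeterSystem.rightInvSeq, List.count_cons]
      have h1 : cs.wordProd ω * r * (cs.wordProd ω)⁻¹ = cs.simple i ↔
          (cs.wordProd ω)⁻¹ * cs.simple i * cs.wordProd ω = r := by
        rw [mul_inv_eq_iff_eq_mul, mul_assoc, inv_mul_eq_iff_eq_mul, eq_comm]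
      ext
      · simp [flip, mul_assoc]
      · simp only [flip, h1, beq_iff_eq]
        push_cast
        exact add_assoc _ _ _
  have key' (w r : W) (e : ZMod 2) :
      ρ w (r, e) = (w * r * w⁻¹, e + (ρ w (r, 0)).2) := by
    obtain ⟨ω, rfl⟩ := cs.wordProd_surjective w
    rw [key, key, zero_add]
  have hmul (w v r : W) : (ρ (w * v) (r, 0)).2 = (ρ v (r, 0)).2 + (ρ w (v * r * v⁻¹, 0)).2 := by
    rw [map_mul]
    change (ρ w (ρ v (r, 0))).2 = _
    rw [key' v, key' w, zero_add]
  have hself (s : B) : (ρ (cs.simple s) (cs.simple s, 0)).2 = 1 := by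
    rw [hρ]; simp [flip]
  have hlen (w r : W) (h : (ρ w (r, 0)).2 ≠ 0) : cs.length (w * r) < cs.length w := by
    obtain ⟨ω, hω, rfl⟩ := cs.exists_isReduced w
    rw [key, zero_add] at h
    refine (cs.isRightInversion_of_mem_rightInvSeq hω ?_).2
    by_contra hn
    rw [List.count_eq_zero_of_not_mem hn] at h
    exact h Nat.cast_zero
  refine ⟨fun w r => (ρ w (r, 0)).2, hmul, hlen, fun w s hs => ?_⟩
  -- Since `w = (ws)s`, this gives `η w s = 1 + η (ws) s`. The last term vanishes, as otherwise `w`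
  -- would be shorter than `ws`.
  have h1 := hmul (w * cs.simple s) (cs.simple s) (cs.simple s)
  rw [cs.simple_mul_simple_cancel_right, mul_inv_cancel_right, hself] at h1
  change (ρ w (cs.simple s, 0)).2 = 1
  rw [h1, add_eq_left]
  by_contra hne
  have := hlen _ _ hne
  rw [cs.simple_mul_simple_cancel_right] at this
  omega

theorem simple_mul_comm_of_ne_zero (hM : M.IsRightAngled) {s t : B} (hst : s ≠ t) (h : M s t ≠ 0) :
    cs.simple s * cs.simple t = cs.simple t * cs.simple s := by
  have h2 : M s t = 2 := by
    rcases hM s t with h1 | h1 | h1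
    · exact absurd h1 (M.off_diagonal s t hst)
    · exact h1
    · exact absurd h1 h
  have := cs.simple_mul_simple_pow s t
  rw [h2, pow_two, mul_eq_one_iff_eq_inv] at this
  simpa using this

/-- When `m_{st} = ∞`, the group retracts onto the infinite dihedral group generated by `s` and
`t`, acting on its chambers numbered by the integers. -/
theorem exists_dihedral_hom (hM : M.IsRightAngled) {s t : B} (hst : s ≠ t) (h0 : M s t = 0) :
    ∃ χ : W →* Equiv.Perm ℤ, χ (cs.simple s) = Equiv.subLeft 1 ∧
      χ (cs.simple t) = Equiv.subLeft (-1) ∧ ∀ w, (χ w 0).natAbs ≤ cs.length w := by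
  classical
  let f : B → Equiv.Perm ℤ := fun i =>
    if i = s then Equiv.subLeft 1 else if i = t then Equiv.subLeft (-1) else 1
  have hsq (i : B) : f i * f i = 1 := by
    ext k
    simp only [f]
    split_ifs <;> simp
  have hl : M.IsLiftable f := by
    intro i j
    rcases hM i j with h1 | h1 | h1
    · have : i = j := by
        by_contra hne; exact M.off_diagonal i j hne h1
      subst this
      rw [h1, pow_one, hsq]
    · have hc : f i * f j = f j * f i := by
        by_cases hi : i = s ∨ i = t
        · by_cases hj : j = s ∨ j = t
          · have hts : M t s = 0 := by rw [M.symmetric]; exact h0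
            rcases hi with rfl | rfl <;> rcases hj with rfl | rfl
            · rfl
            · omega
            · omega
            · rfl
          · have : f j = 1 := by simp only [f]; rw [if_neg (by tauto), if_neg (by tauto)]
            rw [this, mul_one, one_mul]
        · have : f i = 1 := by simp only [f]; rw [if_neg (by tauto), if_neg (by tauto)]
          rw [this, mul_one, one_mul]
      rw [h1, pow_two, mul_assoc, ← mul_assoc (f j), ← hc, mul_assoc, hsq, mul_one, hsq]
    · rw [h1, pow_zero]
  refine ⟨cs.lift ⟨f, hl⟩, ?_, ?_, ?_⟩
  · rw [cs.lift_apply_simple hl]; simp [f]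
  · rw [cs.lift_apply_simple hl]; simp [f, hst.symm]
  · intro w
    obtain ⟨ω, hω, rfl⟩ := cs.exists_isReduced w
    rw [hω.eq]
    clear hω
    induction ω with
    | nil => simp
    | cons i ω ih =>
      rw [cs.wordProd_cons, map_mul, cs.lift_apply_simple hl, Equiv.Perm.mul_apply,
        List.length_cons]
      generalize (cs.lift ⟨f, hl⟩ (cs.wordProd ω)) 0 = k at ih ⊢
      simp only [f]
      split_ifs <;> simp <;> omega

theorem exists_eq_zpow_of_mem_closure {s t : B} {d : W}
    (hd : d ∈ Subgroup.closure {cs.simple s, cs.simple t}) :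
    ∃ m : ℤ, d = (cs.simple s * cs.simple t) ^ m ∨
      d = (cs.simple s * cs.simple t) ^ m * cs.simple s := by
  have ht : (cs.simple s * cs.simple t)⁻¹ * cs.simple s = cs.simple t := by simp
  have step (x : W) (y : W) (hy : y ∈ ({cs.simple s, cs.simple t} : Set W))
      (hx : ∃ m : ℤ, x = (cs.simple s * cs.simple t) ^ m ∨
        x = (cs.simple s * cs.simple t) ^ m * cs.simple s) :
      ∃ m : ℤ, x * y = (cs.simple s * cs.simple t) ^ m ∨
        x * y = (cs.simple s * cs.simple t) ^ m * cs.simple s := by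
    obtain ⟨m, rfl | rfl⟩ := hx <;> rcases hy with rfl | rfl
    · exact ⟨m, Or.inr rfl⟩
    · refine ⟨m - 1, Or.inr ?_⟩
      rw [zpow_sub_one, mul_assoc, ht]
    · exact ⟨m, Or.inl (by simp)⟩
    · refine ⟨m + 1, Or.inl ?_⟩
      rw [zpow_add_one, mul_assoc]
  induction hd using Subgroup.closure_induction_right with
  | one => exact ⟨0, Or.inl (by simp)⟩
  | mul_right x hx y hy ih => exact step x y hy ih
  | mul_inv_cancel x hx y hy ih =>
    have : y⁻¹ = y := by rcases hy with rfl | rfl <;> simp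
    rw [this]; exact step x y hy ih

theorem length_pow_le (s t : B) (n : ℕ) :
    cs.length ((cs.simple s * cs.simple t) ^ n) ≤ 2 * n := by
  induction n with
  | zero => simp
  | succ n ih =>
    rw [pow_succ]
    have h1 := cs.length_mul_le ((cs.simple s * cs.simple t) ^ n) (cs.simple s * cs.simple t)
    have h2 := cs.length_mul_le (cs.simple s) (cs.simple t)
    rw [cs.length_simple, cs.length_simple] at h2
    omega

/-- The numbers `2m` and `2m + 1` are the images of `0` under these elements in the action of
`exists_dihedral_hom`, so these upper bounds match the lower bounds given there. -/
theorem length_zpow_le (s t : B) (m : ℤ) :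
    cs.length ((cs.simple s * cs.simple t) ^ m) ≤ (2 * m).natAbs ∧
    cs.length ((cs.simple s * cs.simple t) ^ m * cs.simple s) ≤ (2 * m + 1).natAbs := by
  have e : (cs.simple s * cs.simple t)⁻¹ = cs.simple t * cs.simple s := by simp
  rcases m with n | n
  · have h1 := length_pow_le cs s t n
    have h2 := cs.length_mul_le ((cs.simple s * cs.simple t) ^ n) (cs.simple s)
    rw [cs.length_simple] at h2
    rw [Int.ofNat_eq_natCast, zpow_natCast]
    omega
  · rw [zpow_negSucc, ← inv_pow, e]
    have h1 := length_pow_le cs t s (n + 1)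
    have h2 := length_pow_le cs t s n
    have h3 := cs.length_mul_le ((cs.simple t * cs.simple s) ^ n) (cs.simple t)
    rw [cs.length_simple] at h3
    have e2 : (cs.simple t * cs.simple s) ^ (n + 1) * cs.simple s =
        (cs.simple t * cs.simple s) ^ n * cs.simple t := by
      rw [pow_succ]; simp [mul_assoc]
    rw [e2]
    omega

theorem not_both_descents_of_mem_closure (hM : M.IsRightAngled) {s t : B} (hst : s ≠ t)
    (h0 : M s t = 0) {d : W} (hd : d ∈ Subgroup.closure {cs.simple s, cs.simple t})
    (h1 : cs.length (d * cs.simple s) < cs.length d)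
    (h2 : cs.length (d * cs.simple t) < cs.length d) : False := by
  obtain ⟨χ, hs, ht, hχ⟩ := exists_dihedral_hom cs hM hst h0
  have ha : χ (cs.simple s * cs.simple t) = Equiv.addLeft 2 := by
    ext k; rw [map_mul, hs, ht]; simp; ring
  have hm (m k : ℤ) : χ ((cs.simple s * cs.simple t) ^ m) k = 2 * m + k := by
    induction m generalizing k with
    | zero => simp
    | succ n ih =>
      rw [zpow_add_one, map_mul, Equiv.Perm.mul_apply, ih, ha, Equiv.coe_addLeft]; ring
    | pred n ih =>
      rw [zpow_sub_one, map_mul, map_inv, Equiv.Perm.mul_apply, ih, ha, Equiv.Perm.inv_def,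
        Equiv.addLeft_symm, Equiv.coe_addLeft]
      ring
  -- The images of `0` under `ds` and `dt` are `χ d 1` and `χ d (-1)`, the two neighbours of `χ d
  -- 0`. One of them has absolute value larger than that of `χ d 0`, hence larger than `|d|`.
  have hls := hχ (d * cs.simple s)
  have hlt := hχ (d * cs.simple t)
  rw [map_mul, Equiv.Perm.mul_apply, hs, Equiv.subLeft_apply] at hls
  rw [map_mul, Equiv.Perm.mul_apply, ht, Equiv.subLeft_apply] at hlt
  obtain ⟨m, hd' | hd'⟩ := exists_eq_zpow_of_mem_closure cs hd
  · have := (length_zpow_le cs s t m).1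
    rw [← hd'] at this
    have hk (k : ℤ) : χ d k = 2 * m + k := by rw [hd', hm]
    rw [hk] at hls hlt
    omega
  · have := (length_zpow_le cs s t m).2
    rw [← hd'] at this
    have hk (k : ℤ) : χ d k = 2 * m + (1 - k) := by
      rw [hd', map_mul, Equiv.Perm.mul_apply, hm, hs, Equiv.subLeft_apply]
    rw [hk] at hls hlt
    omega

/-- If `m_{st} = ∞`, move `u` to a shortest element `ud` of its coset by the infinite dihedral
subgroup `⟨s, t⟩`. The cocycle transfers both descents of `u` to `d⁻¹`, but no element of that
subgroup has both. -/
theorem commute_of_right_descents (hM : M.IsRightAngled) {s t : B} (hst : s ≠ t) {u : W}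
    (hs : cs.length (u * cs.simple s) < cs.length u)
    (ht : cs.length (u * cs.simple t) < cs.length u) :
    cs.simple s * cs.simple t = cs.simple t * cs.simple s := by
  by_cases h0 : M s t = 0
  swap
  · exact simple_mul_comm_of_ne_zero cs hM hst h0
  exfalso
  obtain ⟨η, hη, hηl, hηd⟩ := exists_inversion_cocycle cs hM
  set P := Subgroup.closure {cs.simple s, cs.simple t} with hP
  obtain ⟨d, hmin⟩ : ∃ d : P, ∀ e : P, cs.length (u * d) ≤ cs.length (u * e) := by
    obtain ⟨d, -, hd⟩ := WellFounded.has_min (measure fun d : P => cs.length (u * d)).wf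
      Set.univ ⟨1, trivial⟩
    exact ⟨d, fun e => not_lt.1 (hd e trivial)⟩
  have key (x : B) (hx : cs.simple x ∈ P) (hxu : cs.length (u * cs.simple x) < cs.length u) :
      cs.length ((d : W)⁻¹ * cs.simple x) < cs.length (d : W)⁻¹ := by
    apply hηl
    have e2 := hη (u * d) (d : W)⁻¹ (cs.simple x)
    rw [mul_inv_cancel_right, hηd u x hxu] at e2
    -- Otherwise `ud · d⁻¹xd = u(xd)` would be shorter than `ud`, although it lies in the same
    -- coset.
    have e3 : η (u * d) ((d : W)⁻¹ * cs.simple x * (d : W)⁻¹⁻¹) = 0 := by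
      by_contra hne
      have h1 := hηl _ _ hne
      have h2 := hmin ⟨cs.simple x * d, P.mul_mem hx d.2⟩
      have e4 : u * (d : W) * ((d : W)⁻¹ * cs.simple x * (d : W)⁻¹⁻¹) =
        u * (cs.simple x * (d : W)) := by group
      rw [e4] at h1
      exact absurd h1 (not_lt.2 h2)
    rw [e3, add_zero] at e2
    rw [← e2]; exact one_ne_zero
  exact not_both_descents_of_mem_closure cs hM hst h0 (P.inv_mem d.2)
    (key s (Subgroup.subset_closure (by simp)) hs) (key t (Subgroup.subset_closure (by simp)) ht)

/-- As `s` and `t` commute, the cocycle identity reads `η (us) t = η s t + η u t = 0 + 1`. -/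
theorem length_mul_simple_mul_simple_lt (hM : M.IsRightAngled) {s t : B} (hst : s ≠ t) {u : W}
    (hs : cs.length (u * cs.simple s) < cs.length u)
    (ht : cs.length (u * cs.simple t) < cs.length u) :
    cs.length (u * cs.simple s * cs.simple t) < cs.length (u * cs.simple s) := by
  obtain ⟨η, hη, hηl, hηd⟩ := exists_inversion_cocycle cs hM
  have hc := commute_of_right_descents cs hM hst hs ht
  apply hηl
  have e2 := hη u (cs.simple s) (cs.simple t)
  rw [hc, mul_inv_cancel_right, hηd u t ht] at e2
  have e3 : η (cs.simple s) (cs.simple t) = 0 := by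
    by_contra hne
    have h1 := hηl _ _ hne
    rw [cs.length_simple, Nat.lt_one_iff, cs.length_eq_zero_iff] at h1
    apply hst
    apply simple_conj_eq (cs := cs) hM (w := 1)
    rw [mul_eq_one_iff_eq_inv, cs.inv_simple] at h1
    simpa using h1
  rw [e2, e3, zero_add]; exact one_ne_zero

end Descents

/-! ### Effect on length of conjugation by a simple reflection. -/

section Conjugation

variable {B W : Type*} [Group W] {M : CoxeterMatrix B} (cs : CoxeterSystem M W)

/-- A left descent `t` can change under right multiplication by `s` only when the exchange property
yields `tw = ws` (or the same with `ws` for `w`), and then `s = t`. No commutation of `s` and `t` is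
needed here, unlike for multiplication on the same side. -/
theorem isLeftDescent_mul_simple_iff (hM : M.IsRightAngled) {s t : B} (hst : s ≠ t) (w : W) :
    cs.IsLeftDescent (w * cs.simple s) t ↔ cs.IsLeftDescent w t := by
  have key (w : W) (h : cs.length w < cs.length (w * cs.simple s)) :
      cs.IsLeftDescent (w * cs.simple s) t ↔ cs.IsLeftDescent w t := by
    unfold CoxeterSystem.IsLeftDescent
    rw [← mul_assoc]
    have h1 := cs.length_simple_mul w t
    have h2 := cs.length_mul_simple w s
    have h3 := cs.length_mul_simple (cs.simple t * w) s
    have h4 := cs.length_simple_mul (w * cs.simple s) t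
    rw [← mul_assoc] at h4
    constructor
    · intro h5
      by_contra h6
      have h7 := exchange (cs := cs) hM (s := t) (t := s) (w := w) (by omega) h (by omega)
      exact hst (simple_conj_eq hM h7).symm
    · intro h5
      omega
  rcases cs.length_mul_simple w s with h | h
  · exact key w (by omega)
  · have := key (w * cs.simple s) (by rw [cs.simple_mul_simple_cancel_right]; omega)
    rw [cs.simple_mul_simple_cancel_right] at this
    exact this.symm

theorem isRightDescent_simple_mul_iff (hM : M.IsRightAngled) {s t : B} (hst : s ≠ t) (w : W) :
    cs.IsRightDescent (cs.simple s * w) t ↔ cs.IsRightDescent w t := by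
  rw [← cs.isLeftDescent_inv_iff, mul_inv_rev, cs.inv_simple,
    isLeftDescent_mul_simple_iff cs hM hst, cs.isLeftDescent_inv_iff]

theorem isRightDescent_mul_simple_iff (hM : M.IsRightAngled) {s t : B} (hst : s ≠ t)
    (hc : cs.simple s * cs.simple t = cs.simple t * cs.simple s) (w : W) :
    cs.IsRightDescent (w * cs.simple s) t ↔ cs.IsRightDescent w t := by
  have key (w : W) (h : cs.length (w * cs.simple s) < cs.length w) :
      cs.IsRightDescent (w * cs.simple s) t ↔ cs.IsRightDescent w t := by
    refine ⟨fun h1 => ?_, fun h1 => length_mul_simple_mul_simple_lt cs hM hst h h1⟩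
    unfold CoxeterSystem.IsRightDescent at h1 ⊢
    rw [mul_assoc, hc, ← mul_assoc] at h1
    have := cs.length_mul_simple (w * cs.simple t) s
    omega
  rcases cs.length_mul_simple w s with h | h
  · have := key (w * cs.simple s) (by rw [cs.simple_mul_simple_cancel_right]; omega)
    rw [cs.simple_mul_simple_cancel_right] at this
    exact this.symm
  · exact key w (by omega)

theorem isLeftDescent_simple_mul_iff (hM : M.IsRightAngled) {s t : B} (hst : s ≠ t)
    (hc : cs.simple s * cs.simple t = cs.simple t * cs.simple s) (w : W) :
    cs.IsLeftDescent (cs.simple s * w) t ↔ cs.IsLeftDescent w t := by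
  rw [← cs.isRightDescent_inv_iff, mul_inv_rev, cs.inv_simple,
    isRightDescent_mul_simple_iff cs hM hst hc, cs.isRightDescent_inv_iff]

theorem commute_of_left_descents (hM : M.IsRightAngled) {s t : B} (hst : s ≠ t) {u : W}
    (hs : cs.IsLeftDescent u s) (ht : cs.IsLeftDescent u t) :
    cs.simple s * cs.simple t = cs.simple t * cs.simple s :=
  commute_of_right_descents cs hM hst (cs.isRightDescent_inv_iff.2 hs)
    (cs.isRightDescent_inv_iff.2 ht)

/-- If `s` is a descent on both sides but conjugation does not shorten, exchange applied to `sw`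
shows that `s` commutes with `w`. This criterion turns questions about conjugation into questions
about one-sided descents. -/
theorem length_conj_lt_iff (hM : M.IsRightAngled) (s : B) (w : W) :
    cs.length (cs.simple s * w * cs.simple s) < cs.length w ↔
      cs.IsLeftDescent w s ∧ cs.IsRightDescent w s ∧ cs.simple s * w ≠ w * cs.simple s := by
  unfold CoxeterSystem.IsLeftDescent CoxeterSystem.IsRightDescent
  have h1 := cs.length_simple_mul w s
  have h2 := cs.length_mul_simple w s
  have h3 := cs.length_mul_simple (cs.simple s * w) s
  have h4 := cs.length_simple_mul (w * cs.simple s) s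
  rw [← mul_assoc] at h4
  constructor
  · intro h
    refine ⟨by omega, by omega, fun e => ?_⟩
    rw [e, cs.simple_mul_simple_cancel_right] at h
    exact lt_irrefl _ h
  · rintro ⟨hl, hr, hne⟩
    by_contra h
    have e := exchange (cs := cs) hM (s := s) (t := s) (w := cs.simple s * w)
      (by rw [cs.simple_mul_simple_cancel_left]; exact hl) (by omega)
      (by rwa [cs.simple_mul_simple_cancel_left])
    rw [cs.simple_mul_simple_cancel_left] at e
    apply hne
    nth_rw 2 [e]
    rw [cs.simple_mul_simple_cancel_right]

theorem lt_length_conj_iff (hM : M.IsRightAngled) (s : B) (w : W) :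
    cs.length w < cs.length (cs.simple s * w * cs.simple s) ↔
      ¬ cs.IsLeftDescent w s ∧ ¬ cs.IsRightDescent w s ∧
        cs.simple s * w ≠ w * cs.simple s := by
  unfold CoxeterSystem.IsLeftDescent CoxeterSystem.IsRightDescent
  have h1 := cs.length_simple_mul w s
  have h2 := cs.length_mul_simple w s
  have h3 := cs.length_mul_simple (cs.simple s * w) s
  have h4 := cs.length_simple_mul (w * cs.simple s) s
  rw [← mul_assoc] at h4
  constructor
  · intro h
    refine ⟨by omega, by omega, fun e => ?_⟩
    rw [e, cs.simple_mul_simple_cancel_right] at h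
    exact lt_irrefl _ h
  · rintro ⟨hl, hr, hne⟩
    by_contra h
    exact hne (exchange (cs := cs) hM (by omega) (by omega) (by omega))

theorem commute_of_length_conj_lt (hM : M.IsRightAngled) {s t : B} (hst : s ≠ t) {w : W}
    (hs : cs.length (cs.simple s * w * cs.simple s) < cs.length w)
    (ht : cs.length (cs.simple t * w * cs.simple t) < cs.length w) :
    cs.simple s * cs.simple t = cs.simple t * cs.simple s :=
  commute_of_left_descents cs hM hst ((length_conj_lt_iff cs hM s w).1 hs).1
    ((length_conj_lt_iff cs hM t w).1 ht).1

theorem commutes_simple_mul_iff {s t : B}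
    (hc : cs.simple s * cs.simple t = cs.simple t * cs.simple s) (w : W) :
    cs.simple t * (cs.simple s * w) = cs.simple s * w * cs.simple t ↔
      cs.simple t * w = w * cs.simple t := by
  rw [← mul_assoc, ← hc, mul_assoc, mul_assoc, mul_right_inj]

theorem commutes_mul_simple_iff {s t : B}
    (hc : cs.simple s * cs.simple t = cs.simple t * cs.simple s) (w : W) :
    cs.simple t * (w * cs.simple s) = w * cs.simple s * cs.simple t ↔
      cs.simple t * w = w * cs.simple t := by
  rw [mul_assoc w, hc, ← mul_assoc, ← mul_assoc, mul_left_inj]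

theorem length_conj_simple_mul_lt_iff (hM : M.IsRightAngled) {s t : B} (hst : s ≠ t)
    (hc : cs.simple s * cs.simple t = cs.simple t * cs.simple s) (w : W) :
    cs.length (cs.simple t * (cs.simple s * w) * cs.simple t) < cs.length (cs.simple s * w) ↔
      cs.length (cs.simple t * w * cs.simple t) < cs.length w := by
  rw [length_conj_lt_iff cs hM, length_conj_lt_iff cs hM,
    isLeftDescent_simple_mul_iff cs hM hst hc, isRightDescent_simple_mul_iff cs hM hst,
    Ne, commutes_simple_mul_iff cs hc]

theorem length_conj_mul_simple_lt_iff (hM : M.IsRightAngled) {s t : B} (hst : s ≠ t)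
    (hc : cs.simple s * cs.simple t = cs.simple t * cs.simple s) (w : W) :
    cs.length (cs.simple t * (w * cs.simple s) * cs.simple t) < cs.length (w * cs.simple s) ↔
      cs.length (cs.simple t * w * cs.simple t) < cs.length w := by
  rw [length_conj_lt_iff cs hM, length_conj_lt_iff cs hM,
    isLeftDescent_mul_simple_iff cs hM hst, isRightDescent_mul_simple_iff cs hM hst hc,
    Ne, commutes_mul_simple_iff cs hc]

theorem lt_length_conj_conj_iff (hM : M.IsRightAngled) {s t : B} (hst : s ≠ t)
    (hc : cs.simple s * cs.simple t = cs.simple t * cs.simple s) (w : W) :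
    cs.length (cs.simple s * w * cs.simple s) <
        cs.length (cs.simple t * (cs.simple s * w * cs.simple s) * cs.simple t) ↔
      cs.length w < cs.length (cs.simple t * w * cs.simple t) := by
  rw [lt_length_conj_iff cs hM, lt_length_conj_iff cs hM,
    isLeftDescent_mul_simple_iff cs hM hst, isRightDescent_mul_simple_iff cs hM hst hc,
    Ne, commutes_mul_simple_iff cs hc,
    isLeftDescent_simple_mul_iff cs hM hst hc, isRightDescent_simple_mul_iff cs hM hst,
    commutes_simple_mul_iff cs hc]

theorem length_conj_conj_lt_iff (hM : M.IsRightAngled) {s t : B} (hst : s ≠ t)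
    (hc : cs.simple s * cs.simple t = cs.simple t * cs.simple s) (w : W) :
    cs.length (cs.simple t * (cs.simple s * w * cs.simple s) * cs.simple t) <
        cs.length (cs.simple s * w * cs.simple s) ↔
      cs.length (cs.simple t * w * cs.simple t) < cs.length w := by
  rw [length_conj_mul_simple_lt_iff cs hM hst hc, length_conj_simple_mul_lt_iff cs hM hst hc]

/-! ### Cyclically reduced elements and minimal length in a conjugacy class. -/

theorem length_conj_trichotomy (s : B) (w : W) :
    cs.length (cs.simple s * w * cs.simple s) + 2 = cs.length w ∨
      cs.length (cs.simple s * w * cs.simple s) = cs.length w ∨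
      cs.length (cs.simple s * w * cs.simple s) = cs.length w + 2 := by
  have h1 := cs.length_simple_mul w s
  have h3 := cs.length_mul_simple (cs.simple s * w) s
  omega

theorem simple_conj_conj (s : B) (w : W) :
    cs.simple s * (cs.simple s * w * cs.simple s) * cs.simple s = w := by
  simp [mul_assoc]

/-- A length-preserving conjugation by `s` that moves `w` is a cyclic shift of a reduced word. -/
theorem exists_cyclic_shift (hM : M.IsRightAngled) {s : B} {w : W}
    (h : cs.length (cs.simple s * w * cs.simple s) = cs.length w) :
    cs.simple s * w * cs.simple s = w ∨
      (cs.IsLeftDescent w s ∧ ¬ cs.IsRightDescent w s) ∨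
      (¬ cs.IsLeftDescent w s ∧ cs.IsRightDescent w s) := by
  by_cases hc : cs.simple s * w = w * cs.simple s
  · left; rw [hc, cs.simple_mul_simple_cancel_right]
  · have h1 := (length_conj_lt_iff cs hM s w).not.1 (by omega)
    have h2 := (lt_length_conj_iff cs hM s w).not.1 (by omega)
    tauto

/-- Length-preserving conjugation by a simple reflection keeps an element reducible. -/
theorem exists_length_conj_lt_of_shift (hM : M.IsRightAngled) {s t : B} {w : W}
    (h : cs.length (cs.simple s * w * cs.simple s) = cs.length w)
    (ht : cs.length (cs.simple t * w * cs.simple t) < cs.length w) :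
    cs.simple s * w * cs.simple s = w ∨
      s ≠ t ∧ cs.simple s * cs.simple t = cs.simple t * cs.simple s := by
  have hst : s ≠ t := by rintro rfl; omega
  have h1 := (length_conj_lt_iff cs hM t w).1 ht
  rcases exists_cyclic_shift cs hM h with h2 | h2 | h2
  · exact Or.inl h2
  · exact Or.inr ⟨hst, commute_of_left_descents cs hM hst h2.1 h1.1⟩
  · exact Or.inr ⟨hst, commute_of_right_descents cs hM hst h2.2 h1.2.1⟩

/-- `w` admits no length-decreasing conjugation by a simple reflection. -/
def IsCyclicallyReduced (w : W) : Prop :=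
  ∀ s, cs.length w ≤ cs.length (cs.simple s * w * cs.simple s)

-- If `t` shortened `sws`, then, shifting back by `s`, either `sws = w` or `s` commutes with `t`; in
-- both cases `t` would already shorten `w`.
variable {cs} in
theorem IsCyclicallyReduced.shift (hM : M.IsRightAngled) {w : W} (hw : IsCyclicallyReduced cs w)
    {s : B} (h : cs.length (cs.simple s * w * cs.simple s) = cs.length w) :
    IsCyclicallyReduced cs (cs.simple s * w * cs.simple s) := by
  intro t
  by_contra! ht
  have e := simple_conj_conj cs s w
  rcases exists_length_conj_lt_of_shift cs hM (by rw [e, h]) ht with h1 | ⟨hst, hc⟩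
  · rw [e] at h1
    rw [← h1] at ht
    exact absurd (hw t) (not_le.2 ht)
  · rw [length_conj_conj_lt_iff cs hM hst hc] at ht
    exact absurd (hw t) (not_le.2 ht)

/-- Conjugation by `g` adds `2 |g|` to the length as soon as every right descent of `g` lengthens
`w`. -/
theorem length_conj_of_right_descents (hM : M.IsRightAngled) (n : ℕ) :
    ∀ g w : W, cs.length g = n →
      (∀ s, cs.IsRightDescent g s → cs.length w < cs.length (cs.simple s * w * cs.simple s)) →
      cs.length (g * w * g⁻¹) = cs.length w + 2 * n := by
  induction n with
  | zero =>
    intro g w hg _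
    rw [cs.length_eq_zero_iff] at hg
    subst hg; simp
  | succ n ih =>
    intro g w hg hup
    obtain ⟨s, hs⟩ := cs.exists_rightDescent_of_ne_one (w := g) (by rintro rfl; simp at hg)
    have hsw := hup s hs
    have hlen := length_conj_trichotomy cs s w
    have hs' := cs.isRightDescent_iff.1 hs
    have e : g * w * g⁻¹ = g * cs.simple s * (cs.simple s * w * cs.simple s) *
        (g * cs.simple s)⁻¹ := by
      simp [mul_assoc]
    rw [e, ih (g * cs.simple s) (cs.simple s * w * cs.simple s) (by omega) ?_]
    · omega
    intro t ht
    have hst : s ≠ t := by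
      rintro rfl
      unfold CoxeterSystem.IsRightDescent at ht
      rw [cs.simple_mul_simple_cancel_right] at ht
      omega
    by_cases hc : cs.simple s * cs.simple t = cs.simple t * cs.simple s
    · rw [lt_length_conj_conj_iff cs hM hst hc]
      exact hup t ((isRightDescent_mul_simple_iff cs hM hst hc g).1 ht)
    -- Here `s` shortens `sws`. If `t` does not lengthen `sws`, every case of the trichotomy forces
    -- `s` and `t` to commute, contrary to `hc`.
    · have hred : cs.length (cs.simple s * (cs.simple s * w * cs.simple s) * cs.simple s) <
          cs.length (cs.simple s * w * cs.simple s) := by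
        rwa [simple_conj_conj]
      have hred' := (length_conj_lt_iff cs hM _ _).1 hred
      by_contra! hle
      rcases length_conj_trichotomy cs t (cs.simple s * w * cs.simple s) with h1 | h1 | h1
      · exact hc (commute_of_length_conj_lt cs hM hst hred (by omega))
      · rcases exists_length_conj_lt_of_shift cs hM h1 hred with h2 | ⟨-, h2⟩
        · have h3 : cs.simple t * (cs.simple s * w * cs.simple s) =
              cs.simple s * w * cs.simple s * cs.simple t := by
            nth_rw 2 [← h2]
            rw [cs.simple_mul_simple_cancel_right]
          by_cases h4 : cs.IsLeftDescent (cs.simple s * w * cs.simple s) t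
          · exact hc (commute_of_left_descents cs hM hst hred'.1 h4)
          -- Now `t` commutes with `sws` without being a left descent of it. Then `sws · t = t ·
          -- sws` has left descent `t`, and it keeps the left descent `s` of `sws`.
          · refine hc (commute_of_left_descents cs hM hst
              ((isLeftDescent_mul_simple_iff cs hM hst.symm _).2 hred'.1) ?_)
            rwa [← h3, cs.isLeftDescent_iff_not_isLeftDescent_mul,
              cs.simple_mul_simple_cancel_left]
        · exact hc h2.symm
      · omega

/-- Induct on the length of a conjugating element `g`. Some right descent `s` of `g` must preserve
the length of `w`; replace `w` by `sws` and `g` by `gs`. -/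
theorem IsCyclicallyReduced.induction_on_isConj (hM : M.IsRightAngled) {p : W → Prop}
    (step : ∀ s w, cs.length (cs.simple s * w * cs.simple s) = cs.length w → p w →
      p (cs.simple s * w * cs.simple s)) {w v : W} (hw : IsCyclicallyReduced cs w)
    (hv : IsCyclicallyReduced cs v) (hwv : IsConj w v) (hpw : p w) : p v := by
  obtain ⟨g, hg⟩ := isConj_iff.1 hwv
  obtain ⟨n, hn⟩ : ∃ n, cs.length g = n := ⟨_, rfl⟩
  induction n generalizing g w with
  | zero =>
    rw [cs.length_eq_zero_iff] at hn
    subst hn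
    rw [one_mul, inv_one, mul_one] at hg
    exact hg ▸ hpw
  | succ n ih =>
    by_cases hup : ∀ s, cs.IsRightDescent g s →
        cs.length w < cs.length (cs.simple s * w * cs.simple s)
    -- If all right descents of `g` lengthen `w`, then `|v| = |w| + 2|g|`. For a left descent `s` of
    -- `g`, the element `svs` is the conjugate of `w` by `sg`, so its length is at most `|w| + 2|g|
    -- - 2`, and `v` is not cyclically reduced.
    · exfalso
      have h1 := length_conj_of_right_descents cs hM (n + 1) g w hn hup
      obtain ⟨s, hs⟩ := cs.exists_leftDescent_of_ne_one (w := g) (by rintro rfl; simp at hn)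
      have h2 := cs.length_mul_le (cs.simple s * g * w) (cs.simple s * g)⁻¹
      have h3 := cs.length_mul_le (cs.simple s * g) w
      have h4 := hv s
      have e : cs.simple s * v * cs.simple s = cs.simple s * g * w * (cs.simple s * g)⁻¹ := by
        rw [← hg]; simp [mul_assoc]
      rw [cs.length_inv] at h2
      rw [cs.isLeftDescent_iff] at hs
      rw [e, ← hg] at h4
      omega
    · push Not at hup
      obtain ⟨s, hs, hle⟩ := hup
      have heq := le_antisymm hle (hw s)
      rw [cs.isRightDescent_iff] at hs
      have e : g * cs.simple s * (cs.simple s * w * cs.simple s) * (g * cs.simple s)⁻¹ = v := by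
        rw [← hg]; simp [mul_assoc]
      exact ih (hw.shift hM heq) (isConj_iff.2 ⟨_, e⟩) (step s w heq hpw) _ e (by omega)

theorem isConj_simple_conj (s : B) (w : W) : IsConj w (cs.simple s * w * cs.simple s) :=
  isConj_iff.2 ⟨cs.simple s, by rw [cs.inv_simple]⟩

theorem exists_isConj_isMinLength (w : W) : ∃ v, IsConj w v ∧ IsMinLength cs v := by
  obtain ⟨v, hv, hmin⟩ := WellFounded.has_min (measure cs.length).wf {v | IsConj w v}
    ⟨w, IsConj.refl w⟩
  exact ⟨v, hv, fun u hu => not_lt.1 (hmin u (hv.trans hu))⟩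

variable {cs}

theorem IsMinLength.isCyclicallyReduced {w : W} (hw : IsMinLength cs w) :
    IsCyclicallyReduced cs w :=
  fun s => hw _ (isConj_simple_conj cs s w)

/-- Length is constant along the shifts joining `w` to a minimal element of its class, so local
minimality is global. -/
theorem IsCyclicallyReduced.isMinLength (hM : M.IsRightAngled) {w : W}
    (hw : IsCyclicallyReduced cs w) : IsMinLength cs w := by
  obtain ⟨v, hv, hmin⟩ := exists_isConj_isMinLength cs w
  have h : cs.length v = cs.length w :=
    IsCyclicallyReduced.induction_on_isConj cs hM (p := fun u => cs.length u = cs.length w)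
      (fun s u h1 h2 => h1.trans h2) hw hmin.isCyclicallyReduced hv rfl
  intro u hu
  rw [← h]
  exact hmin u (hv.symm.trans hu)

theorem exists_length_conj_lt (hM : M.IsRightAngled) {w : W} (hw : ¬ IsMinLength cs w) :
    ∃ s, cs.length (cs.simple s * w * cs.simple s) < cs.length w := by
  by_contra! h
  exact hw (IsCyclicallyReduced.isMinLength hM h)

theorem not_isMinLength {s : B} {w : W}
    (h : cs.length (cs.simple s * w * cs.simple s) < cs.length w) : ¬ IsMinLength cs w :=
  fun hw => absurd (hw.isCyclicallyReduced s) (not_le.2 h)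

end Conjugation

/-! ### The functionals `φ_𝒪` are traces. -/

section Traces

variable {B W R : Type*} [Group W] {M : CoxeterMatrix B} (cs : CoxeterSystem M W)
  [CommRing R] (a b : B → R)

theorem T_induction (hM : M.IsRightAngled) {p : Hecke cs a b → Prop} (x : Hecke cs a b)
    (zero : p 0) (T : ∀ w, p (T cs a b hM w)) (add : ∀ x y, p x → p y → p (x + y))
    (smul : ∀ (r : R) x, p x → p (r • x)) : p x := by
  induction (RightAngledHecke.T cs a b hM).mem_span x using Submodule.span_induction with
  | mem x hx => obtain ⟨w, rfl⟩ := hx; exact T w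
  | zero => exact zero
  | add x y _ _ hx hy => exact add x y hx hy
  | smul r x _ hx => exact smul r x hx

theorem T_mul_T_simple (hM : M.IsRightAngled) (s : B) (w : W) :
    T cs a b hM w * T cs a b hM (cs.simple s) =
      if cs.length w < cs.length (w * cs.simple s) then T cs a b hM (w * cs.simple s)
      else a s • T cs a b hM w + b s • T cs a b hM (w * cs.simple s) := by
  split_ifs with h
  · exact T_mul_simple cs a b hM s _ w rfl h
  · have h1 := cs.length_mul_simple w s
    have h2 := T_mul_simple cs a b hM s _ (w * cs.simple s) rfl
      (by rw [cs.simple_mul_simple_cancel_right]; omega)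
    rw [cs.simple_mul_simple_cancel_right] at h2
    have h6 := T_simple_mul cs a b hM s (cs.simple s)
    rw [cs.simple_mul_simple_self, if_neg (by simp), T_one] at h6
    rw [← h2, mul_assoc, h6, mul_add, mul_smul_comm, mul_smul_comm, mul_one, h2]

/-- Each `T_w` is a product of generators `T_s` along a reduced word, and these can be moved
cyclically one at a time. -/
theorem isTrace_of_simple (hM : M.IsRightAngled) (φ : Hecke cs a b →ₗ[R] R)
    (h : ∀ s w, φ (T cs a b hM (cs.simple s) * T cs a b hM w) =
      φ (T cs a b hM w * T cs a b hM (cs.simple s))) : IsTrace R (Hecke cs a b) φ := by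
  have hs (s : B) (y : Hecke cs a b) :
      φ (T cs a b hM (cs.simple s) * y) = φ (y * T cs a b hM (cs.simple s)) := by
    induction y using T_induction cs a b hM with
    | zero => simp
    | T w => exact h s w
    | add x y hx hy => rw [mul_add, add_mul, map_add, map_add, hx, hy]
    | smul r x hx => rw [mul_smul_comm, smul_mul_assoc, map_smul, map_smul, hx]
  have hw (n : ℕ) : ∀ w : W, cs.length w = n → ∀ y : Hecke cs a b,
      φ (T cs a b hM w * y) = φ (y * T cs a b hM w) := by
    induction n with
    | zero =>
      intro w hn y
      rw [cs.length_eq_zero_iff] at hn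
      rw [hn, T_one, one_mul, mul_one]
    | succ n ih =>
      intro w hn y
      obtain ⟨s, hs'⟩ := cs.exists_rightDescent_of_ne_one (w := w) (by rintro rfl; simp at hn)
      rw [cs.isRightDescent_iff] at hs'
      have e := T_mul_simple cs a b hM s _ (w * cs.simple s) rfl
        (by rw [cs.simple_mul_simple_cancel_right]; omega)
      rw [cs.simple_mul_simple_cancel_right] at e
      rw [← e, mul_assoc, ih _ (by omega), mul_assoc, hs, mul_assoc]
  intro x y
  induction x using T_induction cs a b hM with
  | zero => simp
  | T w => exact hw _ w rfl y
  | add x z hx hz => rw [mul_add, add_mul, map_add, map_add, hx, hz]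
  | smul r x hx => rw [mul_smul_comm, smul_mul_assoc, map_smul, map_smul, hx]

variable {cs} in
theorem T_simple_conj_mul_sq (hM : M.IsRightAngled) {s : B} {w : W}
    (h : cs.length (cs.simple s * w * cs.simple s) < cs.length w) :
    T cs a b hM (cs.simple s * w * cs.simple s) * T cs a b hM (cs.simple s) ^ 2 =
      a s • T cs a b hM (cs.simple s * w) + b s • T cs a b hM (cs.simple s * w * cs.simple s) := by
  have h3 := cs.length_simple_mul w s
  have h4 := cs.length_mul_simple (cs.simple s * w) s
  rw [pow_two, ← mul_assoc, T_mul_T_simple, cs.simple_mul_simple_cancel_right,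
    if_pos (by omega), T_mul_T_simple, if_neg (by omega)]

variable [LinearOrder B]

theorem cyclicReduction_of_isMinLength (hM : M.IsRightAngled) {w : W} (hw : IsMinLength cs w) :
    cyclicReduction cs a b hM (T cs a b hM w) = T cs a b hM w := by
  have h : cyclicStep cs a b hM (T cs a b hM w) = T cs a b hM w := by
    rw [cyclicStep, Module.Basis.constr_basis, if_pos hw]
  rw [cyclicReduction, Module.Basis.constr_basis]
  generalize cs.length w = k
  induction k with
  | zero => rfl
  | succ k ih => rw [pow_succ, Module.End.mul_apply, h, ih]

/-- On each element the iterates of `Φ₀` eventually equal `Φ`, so one additional step does not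
matter. This turns the definition of `φ_𝒪` into a recursion on length. -/
theorem cyclicReduction_cyclicStep (hM : M.IsRightAngled) (x : Hecke cs a b) :
    cyclicReduction cs a b hM (cyclicStep cs a b hM x) = cyclicReduction cs a b hM x := by
  have hev (x : Hecke cs a b) : ∀ᶠ n in Filter.atTop,
      (cyclicStep cs a b hM ^ n) x = cyclicReduction cs a b hM x := by
    induction x using T_induction cs a b hM with
    | zero => simp
    | T w => exact cyclicReduction_T cs a b hM w
    | add x y hx hy =>
      filter_upwards [hx, hy] with n h1 h2
      rw [map_add, map_add, h1, h2]
    | smul r x hx =>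
      filter_upwards [hx] with n h1
      rw [map_smul, map_smul, h1]
  obtain ⟨n, h1, h2⟩ := ((hev (cyclicStep cs a b hM x)).and
    ((Filter.tendsto_add_atTop_nat 1).eventually (hev x))).exists
  rw [← h1, ← h2, pow_succ, Module.End.mul_apply]

theorem delocalised_of_isMinLength [DecidableEq (ConjClasses W)] (hM : M.IsRightAngled)
    (O : ConjClasses W) {w : W} (hw : IsMinLength cs w) :
    delocalised cs a b hM O (T cs a b hM w) = if ConjClasses.mk w = O then 1 else 0 := by
  rw [delocalised, LinearMap.comp_apply, cyclicReduction_of_isMinLength cs a b hM hw, sumMinCoeff,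
    Module.Basis.constr_basis]
  simp [hw]

variable [Finite B]

theorem delocalised_least (hM : M.IsRightAngled) (O : ConjClasses W) {w : W}
    (hw : ¬ IsMinLength cs w) : ∃ s, cs.length (cs.simple s * w * cs.simple s) < cs.length w ∧
      delocalised cs a b hM O (T cs a b hM w) =
        a s * delocalised cs a b hM O (T cs a b hM (cs.simple s * w)) +
        b s * delocalised cs a b hM O (T cs a b hM (cs.simple s * w * cs.simple s)) := by
  have h : ∃ s, IsLeast {s | cs.length (cs.simple s * w * cs.simple s) < cs.length w} s :=
    Set.exists_min_image _ id (Set.toFinite _) (exists_length_conj_lt hM hw)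
  refine ⟨h.choose, h.choose_spec.1, ?_⟩
  rw [delocalised, LinearMap.comp_apply, ← cyclicReduction_cyclicStep, ← LinearMap.comp_apply,
    ← delocalised]
  nth_rw 1 [cyclicStep]
  rw [Module.Basis.constr_basis, if_neg hw, dif_pos h,
    T_simple_conj_mul_sq a b hM h.choose_spec.1, map_add, map_smul, map_smul, smul_eq_mul,
    smul_eq_mul]

/-- This frees the recursion from the total order on the generators. If `t` is the reflection used
by `Φ₀` and `s ≠ t` also shortens `w`, then `s` and `t` commute. Expanding along `t` and then `s`
gives the same four terms as expanding along `s` and then `t`, by induction on the shorter elements.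
-/
theorem delocalised_of_length_conj_lt (hM : M.IsRightAngled) (O : ConjClasses W) (n : ℕ) :
    ∀ (w : W) (s : B), cs.length w = n →
      cs.length (cs.simple s * w * cs.simple s) < cs.length w →
      delocalised cs a b hM O (T cs a b hM w) =
        a s * delocalised cs a b hM O (T cs a b hM (cs.simple s * w)) +
        b s * delocalised cs a b hM O (T cs a b hM (cs.simple s * w * cs.simple s)) := by
  induction n using Nat.strong_induction_on with
  | h n ih =>
    intro w s hn hs
    obtain ⟨t, ht, e⟩ := delocalised_least cs a b hM O (not_isMinLength hs)
    by_cases hst : s = t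
    · rw [hst, e]
    have hc := commute_of_length_conj_lt cs hM hst hs ht
    have hsl := ((length_conj_lt_iff cs hM s w).1 hs).1
    have htl := ((length_conj_lt_iff cs hM t w).1 ht).1
    unfold CoxeterSystem.IsLeftDescent at hsl htl
    rw [e,
      ih _ (by omega) (cs.simple t * w) s rfl
        ((length_conj_simple_mul_lt_iff cs hM (Ne.symm hst) hc.symm w).2 hs),
      ih _ (by omega) (cs.simple t * w * cs.simple t) s rfl
        ((length_conj_conj_lt_iff cs hM (Ne.symm hst) hc.symm w).2 hs),
      ih _ (by omega) (cs.simple s * w) t rfl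
        ((length_conj_simple_mul_lt_iff cs hM hst hc w).2 ht),
      ih _ (by omega) (cs.simple s * w * cs.simple s) t rfl
        ((length_conj_conj_lt_iff cs hM hst hc w).2 ht)]
    have e1 : cs.simple s * (cs.simple t * w) = cs.simple t * (cs.simple s * w) := by
      rw [← mul_assoc, hc, mul_assoc]
    have e2 : cs.simple s * (cs.simple t * w * cs.simple t) =
        cs.simple t * (cs.simple s * w) * cs.simple t := by
      rw [← e1]; simp only [mul_assoc]
    have e3 : cs.simple t * (cs.simple s * w * cs.simple s) =
        cs.simple t * (cs.simple s * w) * cs.simple s := by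
      simp only [mul_assoc]
    have e4 : cs.simple t * (cs.simple s * w) * cs.simple t * cs.simple s =
        cs.simple t * (cs.simple s * w) * cs.simple s * cs.simple t := by
      rw [mul_assoc _ (cs.simple t), ← hc, ← mul_assoc]
    rw [e2, e3, e1, e4]
    ring

/-- For `w` of minimal length both values depend only on the conjugacy class. Otherwise some `t`
shortens `w`, and unless `sws = w` it commutes with `s` and shortens `sws` too. The expansions of
both sides along `t` then differ termwise by length-preserving conjugation by `s` of shorter
elements. -/
theorem delocalised_simple_conj (hM : M.IsRightAngled) (O : ConjClasses W) (n : ℕ) :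
    ∀ (w : W) (s : B), cs.length w = n →
      cs.length (cs.simple s * w * cs.simple s) = cs.length w →
      delocalised cs a b hM O (T cs a b hM (cs.simple s * w * cs.simple s)) =
        delocalised cs a b hM O (T cs a b hM w) := by
  classical
  induction n using Nat.strong_induction_on with
  | h n ih =>
    intro w s hn hs
    by_cases hw : IsMinLength cs w
    · rw [delocalised_of_isMinLength _ _ _ _ _ hw, delocalised_of_isMinLength _ _ _ _ _
        ((hw.isCyclicallyReduced.shift hM hs).isMinLength hM),
        ConjClasses.mk_eq_mk_iff_isConj.2 (isConj_simple_conj cs s w).symm]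
    obtain ⟨t, ht⟩ := exists_length_conj_lt hM hw
    rcases exists_length_conj_lt_of_shift cs hM hs ht with h | ⟨hst, hc⟩
    · rw [h]
    have htl := ((length_conj_lt_iff cs hM t w).1 ht).1
    have ht' := (length_conj_conj_lt_iff cs hM hst hc w).2 ht
    have h2 := ((length_conj_lt_iff cs hM t _).1 ht').1
    rw [cs.isLeftDescent_iff] at htl h2
    rw [delocalised_of_length_conj_lt cs a b hM O _ w t rfl ht,
      delocalised_of_length_conj_lt cs a b hM O _ _ t rfl ht']
    have e1 : cs.simple t * (cs.simple s * w * cs.simple s) =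
        cs.simple s * (cs.simple t * w) * cs.simple s := by
      rw [← mul_assoc, ← mul_assoc, ← hc, mul_assoc (cs.simple s)]
    have e2 : cs.simple s * (cs.simple t * w) * cs.simple s * cs.simple t =
        cs.simple s * (cs.simple t * w * cs.simple t) * cs.simple s := by
      rw [mul_assoc _ (cs.simple s) (cs.simple t), hc]; simp only [mul_assoc]
    have h3 := length_conj_trichotomy cs t w
    have h4 := length_conj_trichotomy cs t (cs.simple s * w * cs.simple s)
    rw [e1] at h2 h4 ht'
    rw [e2] at h4 ht'
    rw [e1, e2, ih _ (by omega) (cs.simple t * w) s rfl (by omega),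
      ih _ (by omega) (cs.simple t * w * cs.simple t) s rfl (by omega)]

theorem isTrace_delocalised (hM : M.IsRightAngled) (O : ConjClasses W) :
    IsTrace R (Hecke cs a b) (delocalised cs a b hM O) := by
  apply isTrace_of_simple cs a b hM
  intro s w
  have h1 := cs.length_simple_mul w s
  have h2 := cs.length_mul_simple w s
  have e (h : cs.length (cs.simple s * w) = cs.length (w * cs.simple s)) :
      delocalised cs a b hM O (T cs a b hM (cs.simple s * w)) =
        delocalised cs a b hM O (T cs a b hM (w * cs.simple s)) := by
    have e1 : cs.simple s * (w * cs.simple s) * cs.simple s = cs.simple s * w := by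
      simp [mul_assoc]
    rw [← delocalised_simple_conj cs a b hM O _ (w * cs.simple s) s rfl (by rw [e1, h]), e1]
  rw [T_simple_mul, T_mul_T_simple]
  split_ifs with h3 h4 h4
  · exact e (by omega)
  -- Here `s` shortens `sw` to `ws`, and the recursion for `sw` is exactly the required identity.
  · have e1 : cs.simple s * (cs.simple s * w) * cs.simple s = w * cs.simple s := by simp
    rw [delocalised_of_length_conj_lt cs a b hM O _ (cs.simple s * w) s rfl (by rw [e1]; omega),
      e1, cs.simple_mul_simple_cancel_left]
    simp
  · have e1 : cs.simple s * (w * cs.simple s) * cs.simple s = cs.simple s * w := by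
      simp [mul_assoc]
    have e2 : cs.simple s * (cs.simple s * (w * cs.simple s)) * cs.simple s = w := by
      simp
    -- The recursion for `ws` produces `sws` where `w` is wanted; these have equal length, so shift
    -- invariance exchanges them.
    rw [delocalised_of_length_conj_lt cs a b hM O _ (w * cs.simple s) s rfl (by rw [e1]; omega),
      e1, ← delocalised_simple_conj cs a b hM O _ (cs.simple s * (w * cs.simple s)) s rfl
        (by rw [e2, ← mul_assoc]
            have := cs.length_mul_simple (cs.simple s * w) s
            have := cs.length_simple_mul (w * cs.simple s) s
            rw [← mul_assoc] at this
            omega), e2]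
    simp
  · simp [e (by omega)]

end Traces

/-! ### The basis of the cocentre and uniqueness of traces. -/

section CocentreBasis

variable {B W R : Type*} [Group W] {M : CoxeterMatrix B} (cs : CoxeterSystem M W)
  [CommRing R] (a b : B → R)

theorem Cocentre.mk_mul_comm {A : Type*} [Ring A] [Algebra R A] (x y : A) :
    Cocentre.mk R A (x * y) = Cocentre.mk R A (y * x) :=
  (Submodule.Quotient.eq _).2 (Submodule.subset_span ⟨x, y, rfl⟩)

theorem Cocentre.mk_surjective {A : Type*} [Ring A] [Algebra R A] :
    Function.Surjective (Cocentre.mk R A) :=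
  Submodule.mkQ_surjective _

theorem IsTrace.toCocentre_mk {A : Type*} [Ring A] [Algebra R A] {φ : A →ₗ[R] R}
    (h : IsTrace R A φ) (x : A) : h.toCocentre (Cocentre.mk R A x) = φ x :=
  Submodule.liftQ_apply _ _ _

/-- When the shift moves `w`, exactly one side has the descent `s`, so the two basis elements are
`T_s T_u` and `T_u T_s` for a common shorter `u`. -/
theorem mk_T_simple_conj (hM : M.IsRightAngled) {s : B} {w : W}
    (h : cs.length (cs.simple s * w * cs.simple s) = cs.length w) :
    Cocentre.mk R (Hecke cs a b) (T cs a b hM (cs.simple s * w * cs.simple s)) =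
      Cocentre.mk R (Hecke cs a b) (T cs a b hM w) := by
  rcases exists_cyclic_shift cs hM h with h1 | ⟨h1, -⟩ | ⟨-, h1⟩
  · rw [h1]
  · rw [cs.isLeftDescent_iff] at h1
    have e1 := T_simple_mul cs a b hM s (cs.simple s * w)
    have e2 := T_mul_T_simple cs a b hM s (cs.simple s * w)
    rw [cs.simple_mul_simple_cancel_left, if_pos (by omega)] at e1
    rw [if_pos (by omega)] at e2
    rw [← e1, ← e2, Cocentre.mk_mul_comm]
  · rw [cs.isRightDescent_iff] at h1
    have e1 := T_simple_mul cs a b hM s (w * cs.simple s)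
    have e2 := T_mul_T_simple cs a b hM s (w * cs.simple s)
    rw [cs.simple_mul_simple_cancel_right, if_pos (by omega)] at e2
    rw [← mul_assoc, if_pos (by omega)] at e1
    rw [← e1, ← e2, Cocentre.mk_mul_comm]

theorem mk_T_eq_of_isConj (hM : M.IsRightAngled) {w v : W} (hw : IsMinLength cs w)
    (hv : IsMinLength cs v) (h : IsConj w v) :
    Cocentre.mk R (Hecke cs a b) (T cs a b hM v) =
      Cocentre.mk R (Hecke cs a b) (T cs a b hM w) :=
  IsCyclicallyReduced.induction_on_isConj cs hM
    (p := fun u => Cocentre.mk R (Hecke cs a b) (T cs a b hM u) =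
      Cocentre.mk R (Hecke cs a b) (T cs a b hM w))
    (fun _ _ h1 h2 => (mk_T_simple_conj cs a b hM h1).trans h2)
    hw.isCyclicallyReduced hv.isCyclicallyReduced h rfl

/-- Modulo commutators `T_w = T_s T_{sw}` equals `T_{sw} T_s = T_{sws} T_s²`, which expands by the
quadratic relation. -/
theorem mk_T_of_length_conj_lt (hM : M.IsRightAngled) {s : B} {w : W}
    (h : cs.length (cs.simple s * w * cs.simple s) < cs.length w) :
    Cocentre.mk R (Hecke cs a b) (T cs a b hM w) =
      a s • Cocentre.mk R (Hecke cs a b) (T cs a b hM (cs.simple s * w)) +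
      b s • Cocentre.mk R (Hecke cs a b) (T cs a b hM (cs.simple s * w * cs.simple s)) := by
  have h3 := cs.length_simple_mul w s
  have h4 := cs.length_mul_simple (cs.simple s * w) s
  have e1 := T_simple_mul cs a b hM s (cs.simple s * w)
  have e2 := T_mul_T_simple cs a b hM s (cs.simple s * w * cs.simple s)
  rw [cs.simple_mul_simple_cancel_left, if_pos (by omega)] at e1
  rw [cs.simple_mul_simple_cancel_right, if_pos (by omega)] at e2
  have e3 := congrArg (Cocentre.mk R (Hecke cs a b)) (T_simple_conj_mul_sq a b hM h)
  rw [pow_two, ← mul_assoc, e2, Cocentre.mk_mul_comm, e1, map_add, map_smul, map_smul] at e3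
  exact e3

theorem span_mk_T_isMinLength (hM : M.IsRightAngled) :
    Submodule.span R {z | ∃ w, IsMinLength cs w ∧
      z = Cocentre.mk R (Hecke cs a b) (T cs a b hM w)} = ⊤ := by
  have hT (n : ℕ) : ∀ w, cs.length w = n → Cocentre.mk R (Hecke cs a b) (T cs a b hM w) ∈
      Submodule.span R {z | ∃ w, IsMinLength cs w ∧
        z = Cocentre.mk R (Hecke cs a b) (T cs a b hM w)} := by
    induction n using Nat.strong_induction_on with
    | h n ih =>
      intro w hn
      by_cases hw : IsMinLength cs w
      · exact Submodule.subset_span ⟨w, hw, rfl⟩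
      obtain ⟨s, hs⟩ := exists_length_conj_lt hM hw
      have hl := ((length_conj_lt_iff cs hM s w).1 hs).1
      unfold CoxeterSystem.IsLeftDescent at hl
      rw [mk_T_of_length_conj_lt cs a b hM hs]
      exact Submodule.add_mem _ (Submodule.smul_mem _ _ (ih _ (by omega) _ rfl))
        (Submodule.smul_mem _ _ (ih _ (by omega) _ rfl))
  rw [eq_top_iff]
  rintro z -
  obtain ⟨x, rfl⟩ := Cocentre.mk_surjective z
  induction x using T_induction cs a b hM with
  | zero => rw [map_zero]; exact Submodule.zero_mem _
  | T w => exact hT _ w rfl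
  | add x y hx hy => rw [map_add]; exact Submodule.add_mem _ hx hy
  | smul r x hx => rw [map_smul]; exact Submodule.smul_mem _ _ hx

/-- A trace is determined by its values on the elements of minimal length. -/
theorem IsTrace.ext_isMinLength (hM : M.IsRightAngled) {φ ψ : Hecke cs a b →ₗ[R] R}
    (hφ : IsTrace R (Hecke cs a b) φ) (hψ : IsTrace R (Hecke cs a b) ψ)
    (h : ∀ w, IsMinLength cs w → φ (T cs a b hM w) = ψ (T cs a b hM w)) : φ = ψ := by
  have h1 : hφ.toCocentre = hψ.toCocentre := by
    refine LinearMap.ext_on (span_mk_T_isMinLength cs a b hM) ?_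
    rintro _ ⟨w, hw, rfl⟩
    rw [hφ.toCocentre_mk, hψ.toCocentre_mk, h w hw]
  ext x
  rw [← hφ.toCocentre_mk, h1, hψ.toCocentre_mk]

variable [LinearOrder B] [Finite B]

theorem eq_delocalised_iff [DecidableEq (ConjClasses W)] (hM : M.IsRightAngled)
    (O : ConjClasses W) (ψ : Hecke cs a b →ₗ[R] R) :
    (IsTrace R (Hecke cs a b) ψ ∧ ∀ w, IsMinLength cs w →
      ψ (T cs a b hM w) = if ConjClasses.mk w = O then 1 else 0) ↔
      ψ = delocalised cs a b hM O := by
  constructor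
  · rintro ⟨hψ, h⟩
    refine hψ.ext_isMinLength cs a b hM (isTrace_delocalised cs a b hM O) fun w hw => ?_
    rw [h w hw, delocalised_of_isMinLength cs a b hM O hw]
  · rintro rfl
    exact ⟨isTrace_delocalised cs a b hM O,
      fun w hw => delocalised_of_isMinLength cs a b hM O hw⟩

theorem exists_cocentre_basis (hM : M.IsRightAngled) :
    ∃ C : Module.Basis (ConjClasses W) R (Cocentre R (Hecke cs a b)),
      ∀ w : W, IsMinLength cs w →
        C (ConjClasses.mk w) = Cocentre.mk R (Hecke cs a b) (T cs a b hM w) := by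
  classical
  have hrep (U : ConjClasses W) : ∃ w, ConjClasses.mk w = U ∧ IsMinLength cs w := by
    obtain ⟨w, rfl⟩ := ConjClasses.mk_surjective U
    obtain ⟨v, hv, hmin⟩ := exists_isConj_isMinLength cs w
    exact ⟨v, ConjClasses.mk_eq_mk_iff_isConj.2 hv.symm, hmin⟩
  choose rep hrep hmin using hrep
  have hli : LinearIndependent R
      (fun U => Cocentre.mk R (Hecke cs a b) (T cs a b hM (rep U))) := by
    rw [linearIndependent_iff']
    intro F g hg O hO
    -- The functional induced by `φ_𝒪` extracts the coefficient at `𝒪` from a linear relation.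
    have h1 := congrArg (isTrace_delocalised cs a b hM O).toCocentre hg
    simp only [map_sum, map_smul, IsTrace.toCocentre_mk, map_zero,
      delocalised_of_isMinLength cs a b hM O (hmin _), hrep, smul_eq_mul, mul_ite, mul_one,
      mul_zero, Finset.sum_ite_eq', if_pos hO] at h1
    exact h1
  have heq (w : W) (hw : IsMinLength cs w) :
      Cocentre.mk R (Hecke cs a b) (T cs a b hM (rep (ConjClasses.mk w))) =
        Cocentre.mk R (Hecke cs a b) (T cs a b hM w) :=
    mk_T_eq_of_isConj cs a b hM hw (hmin _) (ConjClasses.mk_eq_mk_iff_isConj.1 (hrep _).symm)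
  refine ⟨Module.Basis.mk hli ?_, fun w hw => ?_⟩
  · rw [← span_mk_T_isMinLength cs a b hM]
    refine Submodule.span_mono ?_
    rintro _ ⟨w, hw, rfl⟩
    exact ⟨ConjClasses.mk w, heq w hw⟩
  · rw [Module.Basis.mk_apply, heq w hw]

end CocentreBasis

end RightAngledHecke

open Classical RightAngledHecke in
theorem mainTheorem3 {B W R : Type*} [Finite B] [LinearOrder B] [Group W] {M : CoxeterMatrix B}
    (cs : CoxeterSystem M W) (hM : M.IsRightAngled) [CommRing R] (a b : B → R) :
    -- every `φ_𝒪` is a trace, the classes `T_𝒰` are a well-defined basis of the cocentre, and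
    -- the functionals induced by the `φ_𝒪` are dual to it
    (∃ (htr : ∀ O : ConjClasses W, IsTrace R (Hecke cs a b) (delocalised cs a b hM O))
        (C : Module.Basis (ConjClasses W) R (Cocentre R (Hecke cs a b))),
      (∀ w : W, IsMinLength cs w →
        C (ConjClasses.mk w) = Cocentre.mk R (Hecke cs a b) (T cs a b hM w)) ∧
      ∀ O U : ConjClasses W, (htr O).toCocentre (C U) = if O = U then 1 else 0) ∧
    -- on an Iwahori-Hecke algebra `φ_𝒪` is the unique trace with the prescribed values
    (∀ q : B → ℝ, (∀ s, 0 < q s) → ∀ (O : ConjClasses W) (ψ : IwahoriHecke cs q →ₗ[ℂ] ℂ),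
      (IsTrace ℂ (IwahoriHecke cs q) ψ ∧ ∀ w : W, IsMinLength cs w →
        ψ (T cs (iwahoriParam q) 1 hM w) = if ConjClasses.mk w = O then 1 else 0) ↔
      ψ = delocalised cs (iwahoriParam q) 1 hM O) := by
  refine ⟨⟨isTrace_delocalised cs a b hM, ?_⟩, fun q _ O ψ =>
    eq_delocalised_iff cs (iwahoriParam q) 1 hM O ψ⟩
  obtain ⟨C, hC⟩ := exists_cocentre_basis cs a b hM
  refine ⟨C, hC, fun O U => ?_⟩
  obtain ⟨w, rfl⟩ := ConjClasses.mk_surjective U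
  obtain ⟨v, hv, hmin⟩ := exists_isConj_isMinLength cs w
  rw [ConjClasses.mk_eq_mk_iff_isConj.2 hv, hC v hmin, IsTrace.toCocentre_mk,
    delocalised_of_isMinLength cs a b hM O hmin]
  simp only [eq_comm]
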